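/- All Hilbert spaces are finite-dimensional and complex; a density matrix is a positive semidefinite matrix of trace one, and a channel is a completely positive trace-preserving linear map between matrix algebras (input and output dimensions may differ). For a channel $\Omega$ and a density matrix $\rho$ on its input space put $$S_{\rm av}(\Omega;\rho)=\inf\Big\{\sum_k p_k\,S(\Omega(\rho_k)) \;:\; \sum_k p_k\rho_k=\rho\Big\},$$ where the infimum is over all finite ensembles $\{p_k,\rho_k\}$ of density matrices $\rho_k$ with probabilities $p_k\ge 0$, $\sum_k p_k=1$, and $S(\sigma)=-\operatorname{Tr}\sigma\log\sigma$ is the von Neumann entropy. Let $\Phi$ be an entanglement-breaking channel, i.e. $\Phi(\rho)=\sum_{k=1}^K R_k\operatorname{Tr}(X_k\rho)$ with density matrices $R_k$ and a POVM $\{X_k\}$ ($X_k\ge 0$, $\sum_k X_k=I$), and let $\Omega$ be an arbitrary channel. Then for every bipartite density matrix $\tau_{12}$ on the tensor product of the input spaces of $\Phi$ and $\Omega$, with reduced density matrices $\tau_1=\operatorname{Tr}_2\tau_{12}$ and $\tau_2=\operatorname{Tr}_1\tau_{12}$, $$S_{\rm av}(\Phi\otimes\Omega;\tau_{12})\;\ge\;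 S_{\rm av}(\Phi;\tau_1)+S_{\rm av}(\Omega;\tau_2).$$ -/

import Mathlib

open scoped Kronecker ComplexOrder

noncomputable section

/-- Density matrices: positive semidefinite with trace one. -/
def IsDensityMatrix {A : Type*} [Fintype A] (ρ : Matrix A A ℂ) : Prop :=
  ρ.PosSemidef ∧ ρ.trace = 1

/-- The partial trace over the second factor, `Tr₂`. -/
def partialTraceRight {A B : Type*} [Fintype B]
    (τ : Matrix (A × B) (A × B) ℂ) : Matrix A A ℂ :=
  Matrix.of fun i i' => ∑ j, τ (i, j) (i', j)

/-- The partial trace over the first factor, `Tr₁`. -/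
def partialTraceLeft {A B : Type*} [Fintype A]
    (τ : Matrix (A × B) (A × B) ℂ) : Matrix B B ℂ :=
  Matrix.of fun j j' => ∑ i, τ (i, j) (i, j')

/-- The tensor product `Φ ⊗ Ω` of two linear maps between matrix algebras, as a map between the
matrix algebras over the product index types. -/
def tensorMap {A A' B B' : Type*} [Fintype A] [DecidableEq A] [Fintype B] [DecidableEq B]
    (Φ : Matrix A A ℂ →ₗ[ℂ] Matrix A' A' ℂ) (Ω : Matrix B B ℂ →ₗ[ℂ] Matrix B' B' ℂ) :
    Matrix (A × B) (A × B) ℂ →ₗ[ℂ] Matrix (A' × B') (A' × B') ℂ where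
  toFun τ := ∑ i, ∑ i', ∑ j, ∑ j', τ (i, j) (i', j') •
    (Φ (Matrix.single i i' 1) ⊗ₖ Ω (Matrix.single j j' 1))
  map_add' τ σ := by
    simp only [Matrix.add_apply, add_smul, Finset.sum_add_distrib]
  map_smul' c τ := by
    simp only [Matrix.smul_apply, smul_eq_mul, mul_smul, Finset.smul_sum, RingHom.id_apply]

/-- The defining property of `Φ ⊗ Ω`. -/
theorem tensorMap_kronecker {A A' B B' : Type*} [Fintype A] [DecidableEq A] [Fintype B]
    [DecidableEq B] (Φ : Matrix A A ℂ →ₗ[ℂ] Matrix A' A' ℂ)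
    (Ω : Matrix B B ℂ →ₗ[ℂ] Matrix B' B' ℂ) (X : Matrix A A ℂ) (Y : Matrix B B ℂ) :
    tensorMap Φ Ω (X ⊗ₖ Y) = Φ X ⊗ₖ Ω Y := by
  ext ⟨a, b⟩ ⟨a', b'⟩
  have hY : Ω Y = ∑ j, ∑ j', Y j j' • Ω (Matrix.single j j' 1) := by
    conv_lhs => rw [Matrix.matrix_eq_sum_single Y]
    simp only [map_sum, ← map_smul, Matrix.smul_single, smul_eq_mul, mul_one]
  have hX : Φ X = ∑ i, ∑ i', X i i' • Φ (Matrix.single i i' 1) := by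
    conv_lhs => rw [Matrix.matrix_eq_sum_single X]
    simp only [map_sum, ← map_smul, Matrix.smul_single, smul_eq_mul, mul_one]
  rw [hX, hY]
  simp only [tensorMap, LinearMap.coe_mk, AddHom.coe_mk, Matrix.kroneckerMap_apply,
    Matrix.sum_apply, Matrix.smul_apply, smul_eq_mul]
  rw [Finset.sum_mul]
  refine Finset.sum_congr rfl fun i _ => ?_
  rw [Finset.sum_mul]
  refine Finset.sum_congr rfl fun i' _ => ?_
  rw [Finset.mul_sum]
  refine Finset.sum_congr rfl fun j _ => ?_
  rw [Finset.mul_sum]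
  refine Finset.sum_congr rfl fun j' _ => ?_
  ring

/-- Complete positivity: `id ⊗ Ω` preserves positive semidefiniteness for every ancilla
dimension `n`. -/
def IsCompletelyPositive {B B' : Type*} [Fintype B] [DecidableEq B]
    (Ω : Matrix B B ℂ →ₗ[ℂ] Matrix B' B' ℂ) : Prop :=
  ∀ (n : ℕ) (τ : Matrix (Fin n × B) (Fin n × B) ℂ), τ.PosSemidef →
    (tensorMap (LinearMap.id : Matrix (Fin n) (Fin n) ℂ →ₗ[ℂ] Matrix (Fin n) (Fin n) ℂ)
      Ω τ).PosSemidef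

/-- Quantum channels: completely positive trace-preserving linear maps. -/
def IsChannel {B B' : Type*} [Fintype B] [DecidableEq B] [Fintype B']
    (Ω : Matrix B B ℂ →ₗ[ℂ] Matrix B' B' ℂ) : Prop :=
  IsCompletelyPositive Ω ∧ ∀ X : Matrix B B ℂ, (Ω X).trace = X.trace

/-- Entanglement-breaking channels: `Φ(ρ) = ∑ₖ Rₖ Tr(Xₖ ρ)` with density matrices `Rₖ` and a
POVM `{Xₖ}`. -/
def IsEntanglementBreaking {A A' : Type*} [Fintype A] [DecidableEq A] [Fintype A']
    (Φ : Matrix A A ℂ →ₗ[ℂ] Matrix A' A' ℂ) : Prop :=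
  ∃ (K : ℕ) (R : Fin K → Matrix A' A' ℂ) (X : Fin K → Matrix A A ℂ),
    (∀ k, IsDensityMatrix (R k)) ∧ (∀ k, (X k).PosSemidef) ∧ ∑ k, X k = 1 ∧
      ∀ ρ : Matrix A A ℂ, Φ ρ = ∑ k, (X k * ρ).trace • R k

/-- The von Neumann entropy `S(ρ) = -Tr ρ log ρ`, i.e. the trace of `η(ρ)` with
`η(x) = -x log x`, `η(0) = 0`, applied by functional calculus. -/
def vonNeumannEntropy {A : Type*} [Fintype A] [DecidableEq A] (ρ : Matrix A A ℂ) : ℝ :=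
  (cfc Real.negMulLog ρ).trace.re

/-- `S_av(Ω; ρ)`: the infimum of `∑ₖ pₖ S(Ω(ρₖ))` over all finite ensembles `{pₖ, ρₖ}` of density
matrices with average `∑ₖ pₖ ρₖ = ρ`. For a channel `Ω` and a density matrix `ρ` the set is
nonempty (it contains `S(Ω(ρ))`) and bounded below by `0`. -/
def minAverageEntropy {A A' : Type*} [Fintype A] [Fintype A'] [DecidableEq A']
    (Ω : Matrix A A ℂ →ₗ[ℂ] Matrix A' A' ℂ) (ρ : Matrix A A ℂ) : ℝ :=
  sInf {s : ℝ | ∃ (n : ℕ) (p : Fin n → ℝ) (σ : Fin n → Matrix A A ℂ),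
    (∀ k, 0 ≤ p k) ∧ ∑ k, p k = 1 ∧ (∀ k, IsDensityMatrix (σ k)) ∧
      ∑ k, (p k : ℂ) • σ k = ρ ∧ s = ∑ k, p k * vonNeumannEntropy (Ω (σ k))}

end

/-!
Write `Φ ρ = ∑ k, tr (X k * ρ) • R k`. Measuring the POVM `X` on the first factor of `τ` leaves the
second factor in states `σ k` with probabilities `q k`; they average to the second marginal of `τ`,
and `(Φ ⊗ Ω) τ = ∑ k, q k • R k ⊗ Ω (σ k)`, while `Φ` maps the first marginal to `∑ k, q k • R k`.
So it suffices to show `S (∑ k, R k ⊗ ω k) ≥ S (∑ k, R k) + ∑ k, tr (R k) * S (ω k)` for positive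
semidefinite `R k` and density matrices `ω k`; this is applied to every member of an ensemble for
`τ`.

The entropy inequality follows by pairing with `R k` the operator inequality
`tr₂ ((1 ⊗ ω) * log P) + S ω • 1 ≤ log (tr₂ P)`. In an eigenbasis `w j` of `ω`, with eigenvalues
`l j` and `W j = 1 ⊗ |w j⟩`, this is the operator Jensen inequality for the logarithm, applied to
the operators `(l j)⁻¹ • P` with the Kraus operators `√(l j) • W j`.
-/

open Matrix
open scoped MatrixOrder

section FunctionalCalculus

variable {m n : Type*} [Fintype m] [DecidableEq m] [Fintype n] [DecidableEq n]

open Polynomial in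
theorem aeval_mul_eq_mul_aeval {R S : Type*} [CommSemiring R] [CommSemiring S] [Algebra R S]
    {Y : Matrix m m S} {Z : Matrix n n S} {V : Matrix m n S} (h : Y * V = V * Z) (p : R[X]) :
    aeval Y p * V = V * aeval Z p := by
  induction p using Polynomial.induction_on with
  | C a => simp [Algebra.algebraMap_eq_smul_one]
  | add p q hp hq => rw [map_add, map_add, Matrix.add_mul, Matrix.mul_add, hp, hq]
  | monomial k c ih =>
    rw [pow_succ, ← mul_assoc, map_mul (aeval Y), map_mul (aeval Z), aeval_X, aeval_X,
      Matrix.mul_assoc, h, ← Matrix.mul_assoc, ih, Matrix.mul_assoc]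

/-- On the finite spectra of `Y` and `Z` the function `f` agrees with a polynomial. -/
theorem cfc_mul_eq_mul_cfc {Y : Matrix m m ℂ} {Z : Matrix n n ℂ} {V : Matrix m n ℂ}
    (hY : Y.IsHermitian) (hZ : Z.IsHermitian) (h : Y * V = V * Z) (f : ℝ → ℝ) :
    cfc f Y * V = V * cfc f Z := by
  classical
  let p := Lagrange.interpolate (Y.finite_real_spectrum.union Z.finite_real_spectrum).toFinset id f
  have hp : Set.EqOn f p.eval (spectrum ℝ Y ∪ spectrum ℝ Z) := fun x hx =>
    (Lagrange.eval_interpolate_at_node (v := id) f Function.injective_id.injOn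
      ((Set.Finite.mem_toFinset _).2 hx)).symm
  rw [cfc_congr (hp.mono Set.subset_union_left), cfc_congr (hp.mono Set.subset_union_right),
    cfc_polynomial p Y hY.isSelfAdjoint, cfc_polynomial p Z hZ.isSelfAdjoint]
  exact aeval_mul_eq_mul_aeval h p

theorem trace_cfc {M : Matrix n n ℂ} (hM : M.IsHermitian) (f : ℝ → ℝ) :
    (cfc f M).trace = ((∑ i, f (hM.eigenvalues i) : ℝ) : ℂ) := by
  rw [hM.cfc_eq, IsHermitian.cfc, Unitary.conjStarAlgAut_apply, trace_mul_cycle,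
    Unitary.coe_star_mul_self, Matrix.one_mul, trace_diagonal]
  simp

theorem trace_cfc_negMulLog {M : Matrix n n ℂ} (hM : M.IsHermitian) :
    (cfc Real.negMulLog M).trace = vonNeumannEntropy M := by
  rw [vonNeumannEntropy, trace_cfc hM, Complex.ofReal_re]

theorem cfc_eq_sum_vecMulVec {M : Matrix n n ℂ} (hM : M.IsHermitian) (f : ℝ → ℝ) :
    cfc f M = ∑ j, f (hM.eigenvalues j) •
      vecMulVec (hM.eigenvectorBasis j) (star (hM.eigenvectorBasis j).ofLp) := by
  ext a b
  rw [hM.cfc_eq, IsHermitian.cfc, Unitary.conjStarAlgAut_apply, mul_apply, Matrix.sum_apply]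
  simp [mul_diagonal, vecMulVec_apply, mul_comm, mul_assoc]

end FunctionalCalculus

section BlockMatrices

variable {m n o k α : Type*}

/-- The matrix with blocks `K j` stacked on top of each other, with rows indexed as in
`Matrix.blockDiagonal`. -/
def blockColumn (K : k → Matrix m n α) : Matrix (m × k) n α :=
  of fun p b => K p.2 p.1 b

theorem blockDiagonal_mul_blockColumn [NonUnitalNonAssocSemiring α] [Fintype m] [Fintype k]
    [DecidableEq k] (X : k → Matrix o m α) (K : k → Matrix m n α) :
    blockDiagonal X * blockColumn K = blockColumn fun j => X j * K j := by
  ext ⟨a, j⟩ b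
  simp [blockColumn, mul_apply, blockDiagonal_apply, Fintype.sum_prod_type, ite_mul]

theorem conjTranspose_blockColumn_mul_blockColumn [NonUnitalNonAssocSemiring α] [Star α]
    [Fintype m] [Fintype k] (K : k → Matrix m n α) (L : k → Matrix m o α) :
    (blockColumn K)ᴴ * blockColumn L = ∑ j, (K j)ᴴ * L j := by
  ext a b
  simp only [blockColumn, mul_apply, conjTranspose_apply, of_apply, Fintype.sum_prod_type_right,
    Matrix.sum_apply]

theorem posDef_blockDiagonal [Finite m] [Finite k] [DecidableEq k] {X : k → Matrix m m ℂ}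
    (hX : ∀ j, (X j).PosDef) : (blockDiagonal X).PosDef := by
  classical
  cases nonempty_fintype m
  cases nonempty_fintype k
  choose C hC using fun j =>
    CStarAlgebra.nonneg_iff_eq_star_mul_self.1 (hX j).posSemidef.nonneg
  have hpsd : (blockDiagonal X).PosSemidef := by
    rw [show X = fun j => (C j)ᴴ * C j from funext hC, blockDiagonal_mul,
      ← blockDiagonal_conjTranspose]
    exact posSemidef_conjTranspose_mul_self _
  exact hpsd.posDef_iff_isUnit.2
    ((Pi.isUnit_iff.2 fun j => (hX j).isUnit).map (blockDiagonalRingHom m k ℂ))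

theorem posDef_sum_conjTranspose_mul_mul [Fintype m] [Finite n] [DecidableEq n] [Fintype k]
    {X : k → Matrix m m ℂ} (hX : ∀ j, (X j).PosDef) {K : k → Matrix m n ℂ}
    (hK : ∑ j, (K j)ᴴ * K j = 1) : (∑ j, (K j)ᴴ * X j * K j).PosDef := by
  classical
  cases nonempty_fintype n
  have hinj : Function.Injective (blockColumn K).mulVec :=
    Function.LeftInverse.injective (g := (blockColumn K)ᴴ.mulVec) fun x => by
      rw [mulVec_mulVec, conjTranspose_blockColumn_mul_blockColumn, hK, one_mulVec]
  have h := (posDef_blockDiagonal hX).conjTranspose_mul_mul_same hinj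
  simpa only [Matrix.mul_assoc, blockDiagonal_mul_blockColumn,
    conjTranspose_blockColumn_mul_blockColumn] using h

theorem cfc_blockDiagonal [Fintype m] [DecidableEq m] [Fintype k] [DecidableEq k]
    {X : k → Matrix m m ℂ} (hX : ∀ j, (X j).IsHermitian) (f : ℝ → ℝ) :
    cfc f (blockDiagonal X) = blockDiagonal fun j => cfc f (X j) := by
  ext ⟨a, i⟩ ⟨b, j⟩
  let E : Matrix (m × k) m ℂ := (1 : Matrix (m × k) (m × k) ℂ).submatrix id fun c => (c, j)
  have hE : blockDiagonal X * E = E * X j := by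
    ext ⟨c, l⟩ d
    rcases eq_or_ne l j with rfl | hlj <;>
      simp [E, mul_apply, one_apply, blockDiagonal_apply, *]
  have h := congrFun₂ (cfc_mul_eq_mul_cfc (isHermitian_blockDiagonal_iff.2 hX) (hX j) hE f)
    (a, i) b
  rcases eq_or_ne i j with rfl | hij
  · simpa [E, mul_apply, one_apply] using h
  · simpa [E, mul_apply, one_apply, blockDiagonal_apply, hij] using h

end BlockMatrices

section OperatorJensen

variable {m n k α : Type*}

theorem conjTranspose_mul_mul_mono [Fintype m] [Finite n] {X Y : Matrix m m ℂ} (h : X ≤ Y)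
    (V : Matrix m n ℂ) : Vᴴ * X * V ≤ Vᴴ * Y * V := by
  cases nonempty_fintype n
  rw [Matrix.le_iff, ← Matrix.sub_mul, ← Matrix.mul_sub]
  exact (Matrix.le_iff.1 h).conjTranspose_mul_mul_same V

variable [Ring α] [StarRing α] [Fintype n] [DecidableEq m]

/-- The reflection through the range of an isometry `V`. -/
def isometryReflection (V : Matrix m n α) : Matrix m m α :=
  V * Vᴴ + V * Vᴴ - 1

theorem isometryReflection_conjTranspose (V : Matrix m n α) :
    (isometryReflection V)ᴴ = isometryReflection V := by
  simp [isometryReflection]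

variable [Fintype m] [DecidableEq n]

theorem isometryReflection_mul {V : Matrix m n α} (hV : Vᴴ * V = 1) :
    isometryReflection V * V = V := by
  rw [isometryReflection, Matrix.sub_mul, Matrix.add_mul, Matrix.mul_assoc, hV,
    Matrix.mul_one, Matrix.one_mul, add_sub_cancel_right]

theorem isometryReflection_mul_self {V : Matrix m n α} (hV : Vᴴ * V = 1) :
    isometryReflection V * isometryReflection V = 1 := by
  nth_rw 2 [isometryReflection]
  rw [Matrix.mul_sub, Matrix.mul_add, ← Matrix.mul_assoc, isometryReflection_mul hV,
    isometryReflection, Matrix.mul_one, sub_sub_cancel]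

variable [Fintype k] [DecidableEq k] {f : ℝ → ℝ} {V : Matrix m n ℂ}

theorem average_conj_cfc_le_cfc_average (hf : ConcaveOn ℝ {X : Matrix m m ℂ | X.PosDef} (cfc f))
    {X u : Matrix m m ℂ} (hX : X.PosDef) (hu : uᴴ = u) (huu : u * u = 1) :
    (1 / 2 : ℝ) • cfc f X + (1 / 2 : ℝ) • (u * cfc f X * u)
      ≤ cfc f ((1 / 2 : ℝ) • X + (1 / 2 : ℝ) • (u * X * u)) := by
  have hXu : (u * X * u).PosDef := by
    have hinj : Function.Injective u.mulVec :=
      Function.LeftInverse.injective (g := u.mulVec) fun x => by simp [huu]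
    simpa only [hu] using hX.conjTranspose_mul_mul_same hinj
  have hcfc : cfc f (u * X * u) * u = u * cfc f X :=
    cfc_mul_eq_mul_cfc hXu.isHermitian hX.isHermitian
      (by rw [Matrix.mul_assoc, huu, Matrix.mul_one]) f
  rw [← hcfc, Matrix.mul_assoc, huu, Matrix.mul_one]
  exact hf.2 hX hXu (by norm_num) (by norm_num) (by norm_num)

/-- Averaging `X` over the reflection through the range of `V` gives an operator `Y` that is
reduced by this range and has the compression `Vᴴ * X * V` there. -/
theorem conjTranspose_mul_cfc_mul_le (hf : ConcaveOn ℝ {X : Matrix m m ℂ | X.PosDef} (cfc f))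
    {X : Matrix m m ℂ} (hX : X.PosDef) (hV : Vᴴ * V = 1) :
    Vᴴ * cfc f X * V ≤ cfc f (Vᴴ * X * V) := by
  set u := isometryReflection V with hu
  have huV : u * V = V := isometryReflection_mul hV
  have hVu : Vᴴ * u = Vᴴ := by
    rw [hu, ← isometryReflection_conjTranspose, ← conjTranspose_mul, huV]
  set Y := (1 / 2 : ℝ) • X + (1 / 2 : ℝ) • (u * X * u) with hY
  have hYV : Y * V = V * (Vᴴ * X * V) := by
    have huXV : u * X * V = V * (Vᴴ * X * V) + V * (Vᴴ * X * V) - X * V := by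
      simp only [hu, isometryReflection, Matrix.sub_mul, Matrix.add_mul, Matrix.mul_assoc,
        Matrix.one_mul]
    rw [hY, Matrix.add_mul, Matrix.smul_mul, Matrix.smul_mul, Matrix.mul_assoc _ u V, huV, huXV]
    module
  have hYH : Y.IsHermitian := by
    have huXu := isHermitian_conjTranspose_mul_mul u hX.isHermitian
    rw [isometryReflection_conjTranspose] at huXu
    exact (hX.isHermitian.smul (star_trivial _)).add (huXu.smul (star_trivial _))
  have hcfc : cfc f Y * V = V * cfc f (Vᴴ * X * V) :=
    cfc_mul_eq_mul_cfc hYH (isHermitian_conjTranspose_mul_mul V hX.isHermitian) hYV f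
  calc Vᴴ * cfc f X * V
      = Vᴴ * ((1 / 2 : ℝ) • cfc f X + (1 / 2 : ℝ) • (u * cfc f X * u)) * V := by
        have h : Vᴴ * (u * cfc f X * u) * V = Vᴴ * cfc f X * V := by
          rw [← Matrix.mul_assoc, ← Matrix.mul_assoc, hVu, Matrix.mul_assoc _ u, huV]
        rw [Matrix.mul_add, Matrix.add_mul, Matrix.mul_smul, Matrix.mul_smul, Matrix.smul_mul,
          Matrix.smul_mul, h]
        module
    _ ≤ Vᴴ * cfc f Y * V := conjTranspose_mul_mul_mono (average_conj_cfc_le_cfc_average hf hX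
        (isometryReflection_conjTranspose V) (isometryReflection_mul_self hV)) V
    _ = cfc f (Vᴴ * X * V) := by
        rw [Matrix.mul_assoc, hcfc, ← Matrix.mul_assoc, hV, Matrix.one_mul]

theorem sum_conjTranspose_mul_cfc_mul_le
    (hf : ConcaveOn ℝ {X : Matrix (m × k) (m × k) ℂ | X.PosDef} (cfc f)) {X : k → Matrix m m ℂ}
    (hX : ∀ j, (X j).PosDef) {K : k → Matrix m n ℂ} (hK : ∑ j, (K j)ᴴ * K j = 1) :
    ∑ j, (K j)ᴴ * cfc f (X j) * K j ≤ cfc f (∑ j, (K j)ᴴ * X j * K j) := by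
  have h := conjTranspose_mul_cfc_mul_le hf (posDef_blockDiagonal hX) (V := blockColumn K)
    (by rw [conjTranspose_blockColumn_mul_blockColumn, hK])
  simpa only [cfc_blockDiagonal fun j => (hX j).isHermitian, Matrix.mul_assoc,
    blockDiagonal_mul_blockColumn, conjTranspose_blockColumn_mul_blockColumn] using h

end OperatorJensen

section Logarithm

variable {m n k : Type*} [Fintype m] [DecidableEq m] [Fintype n] [DecidableEq n]
  [Fintype k]

open scoped Matrix.Norms.L2Operator in
theorem concaveOn_cfc_log :
    ConcaveOn ℝ {X : Matrix n n ℂ | X.PosDef} (cfc Real.log) := by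
  have h := CFC.concaveOn_log (A := Matrix n n ℂ)
  simp only [isStrictlyPositive_iff_posDef] at h
  exact h

open scoped Matrix.Norms.L2Operator in
theorem cfc_log_le_cfc_log {X Y : Matrix n n ℂ} (hX : X.PosDef) (h : X ≤ Y) :
    cfc Real.log X ≤ cfc Real.log Y :=
  CFC.log_le_log h hX.isStrictlyPositive

open scoped Matrix.Norms.L2Operator in
theorem cfc_log_exp_smul (t : ℝ) {X : Matrix n n ℂ} (hX : X.PosDef) :
    cfc Real.log (Real.exp t • X) = t • 1 + cfc Real.log X := by
  have h := CFC.log_smul' X (Real.exp_pos t) hX.isStrictlyPositive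
  rw [Real.log_exp, Algebra.algebraMap_eq_smul_one] at h
  exact h

theorem mul_exp_neg_log_le_one {x : ℝ} (hx : 0 ≤ x) : x * Real.exp (-Real.log x) ≤ 1 := by
  rcases hx.eq_or_lt with rfl | hx
  · simp
  · rw [Real.exp_neg, Real.exp_log hx, mul_inv_cancel₀ hx.ne']

/-- Operator Jensen for the operators `√(l j) • W j` and `(l j)⁻¹ • P`. Writing `(l j)⁻¹` as
`exp (-log (l j))` keeps the latter positive definite also at `l j = 0`, where `log 0 = 0`. -/
theorem sum_smul_conjTranspose_mul_cfc_log_mul_add_le {P : Matrix m m ℂ} (hP : P.PosDef)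
    {l : k → ℝ} (hl : ∀ j, 0 ≤ l j) {W : k → Matrix m n ℂ}
    (hW : ∑ j, l j • ((W j)ᴴ * W j) = 1) :
    ∑ j, l j • ((W j)ᴴ * cfc Real.log P * W j) + ∑ j, Real.negMulLog (l j) • ((W j)ᴴ * W j)
      ≤ cfc Real.log (∑ j, (W j)ᴴ * P * W j) := by
  classical
  let X : k → Matrix m m ℂ := fun j => Real.exp (-Real.log (l j)) • P
  have hX : ∀ j, (X j).PosDef := fun j => hP.smul (Real.exp_pos _)
  have hK : ∀ j (M : Matrix m m ℂ),
      (√(l j) • W j)ᴴ * M * (√(l j) • W j) = l j • ((W j)ᴴ * M * W j) := by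
    intro j M
    rw [conjTranspose_smul, star_trivial, Matrix.smul_mul, Matrix.mul_smul, Matrix.smul_mul,
      smul_smul, Real.mul_self_sqrt (hl j)]
  have hK1 : ∑ j, (√(l j) • W j)ᴴ * (√(l j) • W j) = 1 := by
    rw [← hW]
    exact Finset.sum_congr rfl fun j _ => by simpa only [Matrix.mul_one] using hK j 1
  have hle : ∑ j, (√(l j) • W j)ᴴ * X j * (√(l j) • W j) ≤ ∑ j, (W j)ᴴ * P * W j := by
    refine Finset.sum_le_sum fun j _ => ?_
    have hpsd := (hP.posSemidef.conjTranspose_mul_mul_same (W j)).smul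
      (sub_nonneg.2 (mul_exp_neg_log_le_one (hl j)))
    rwa [sub_smul, one_smul, mul_smul, ← Matrix.smul_mul, ← Matrix.mul_smul _ _ P, ← hK] at hpsd
  have hlog : ∀ j, (√(l j) • W j)ᴴ * cfc Real.log (X j) * (√(l j) • W j)
      = l j • ((W j)ᴴ * cfc Real.log P * W j) + Real.negMulLog (l j) • ((W j)ᴴ * W j) := by
    intro j
    rw [hK, cfc_log_exp_smul _ hP, Matrix.mul_add, Matrix.add_mul, Matrix.mul_smul,
      Matrix.smul_mul, Matrix.mul_one, Real.negMulLog]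
    module
  calc ∑ j, l j • ((W j)ᴴ * cfc Real.log P * W j) + ∑ j, Real.negMulLog (l j) • ((W j)ᴴ * W j)
      = ∑ j, (√(l j) • W j)ᴴ * cfc Real.log (X j) * (√(l j) • W j) := by
        simp only [hlog, Finset.sum_add_distrib]
    _ ≤ cfc Real.log (∑ j, (√(l j) • W j)ᴴ * X j * (√(l j) • W j)) :=
        sum_conjTranspose_mul_cfc_mul_le concaveOn_cfc_log hX hK1
    _ ≤ cfc Real.log (∑ j, (W j)ᴴ * P * W j) :=
        cfc_log_le_cfc_log (posDef_sum_conjTranspose_mul_mul hX hK1) hle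

end Logarithm

section PartialTrace

variable {A B ι : Type*}

theorem partialTraceRight_add [Fintype B] (τ σ : Matrix (A × B) (A × B) ℂ) :
    partialTraceRight (τ + σ) = partialTraceRight τ + partialTraceRight σ := by
  ext i i'
  simp [partialTraceRight, Finset.sum_add_distrib]

theorem partialTraceRight_smul {R : Type*} [DistribSMul R ℂ] [Fintype B] (c : R)
    (τ : Matrix (A × B) (A × B) ℂ) :
    partialTraceRight (c • τ) = c • partialTraceRight τ := by
  ext i i'
  simp [partialTraceRight, Finset.smul_sum]

theorem partialTraceRight_sum [Fintype B] (s : Finset ι) (τ : ι → Matrix (A × B) (A × B) ℂ) :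
    partialTraceRight (∑ k ∈ s, τ k) = ∑ k ∈ s, partialTraceRight (τ k) := by
  ext i i'
  simp only [partialTraceRight, of_apply, Matrix.sum_apply]
  exact Finset.sum_comm

theorem partialTraceRight_kronecker [Fintype B] (X : Matrix A A ℂ) (Y : Matrix B B ℂ) :
    partialTraceRight (X ⊗ₖ Y) = Y.trace • X := by
  ext i i'
  simp [partialTraceRight, ← Finset.mul_sum, trace, mul_comm]

/-- The operator `1 ⊗ |w⟩` that tensors a vector with `w`. -/
def tensorVec (A : Type*) [DecidableEq A] (w : B → ℂ) : Matrix (A × B) A ℂ :=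
  of fun p a => if p.1 = a then w p.2 else 0

theorem kronecker_sum (X : Matrix A A ℂ) (Y : ι → Matrix B B ℂ) (s : Finset ι) :
    X ⊗ₖ (∑ k ∈ s, Y k) = ∑ k ∈ s, X ⊗ₖ Y k :=
  map_sum (kroneckerBilinear (R := ℂ) (α := ℂ) X) Y s

theorem sum_kronecker (X : ι → Matrix A A ℂ) (Y : Matrix B B ℂ) (s : Finset ι) :
    (∑ k ∈ s, X k) ⊗ₖ Y = ∑ k ∈ s, X k ⊗ₖ Y :=
  map_sum ((kroneckerBilinear (R := ℂ) (α := ℂ)).flip Y) X s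

theorem trace_kronecker_one_mul [Fintype A] [Fintype B] [DecidableEq B]
    (X : Matrix A A ℂ) (M : Matrix (A × B) (A × B) ℂ) :
    ((X ⊗ₖ (1 : Matrix B B ℂ)) * M).trace = (X * partialTraceRight M).trace := by
  simp only [trace, diag_apply, partialTraceRight, of_apply, mul_apply,
    Fintype.sum_prod_type, kroneckerMap_apply, one_apply, mul_ite, ite_mul, mul_one, mul_zero,
    zero_mul, Finset.sum_ite_eq, Finset.mem_univ, if_true, Finset.mul_sum]
  exact Finset.sum_congr rfl fun _ _ => Finset.sum_comm

theorem trace_kronecker_mul [Fintype A] [DecidableEq A] [Fintype B]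
    (X : Matrix A A ℂ) (Y : Matrix B B ℂ) (M : Matrix (A × B) (A × B) ℂ) :
    ((X ⊗ₖ Y) * M).trace = (X * partialTraceRight ((1 ⊗ₖ Y) * M)).trace := by
  classical
  rw [← trace_kronecker_one_mul, ← Matrix.mul_assoc, ← mul_kronecker_mul, Matrix.mul_one,
    Matrix.one_mul]

variable [Fintype A] [DecidableEq A] [Fintype B]

theorem partialTraceRight_one_kronecker_vecMulVec_mul (w : B → ℂ) (M : Matrix (A × B) (A × B) ℂ) :
    partialTraceRight ((1 ⊗ₖ vecMulVec w (star w)) * M)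
      = (tensorVec A w)ᴴ * M * tensorVec A w := by
  ext a a'
  simp only [partialTraceRight, tensorVec, of_apply, mul_apply, Fintype.sum_prod_type,
    kroneckerMap_apply, one_apply, conjTranspose_apply, vecMulVec_apply, Pi.star_apply, ite_mul,
    one_mul, zero_mul, apply_ite star, star_zero, mul_ite, mul_zero, Finset.sum_ite_irrel,
    Finset.sum_const_zero, Finset.sum_ite_eq, Finset.sum_ite_eq', Finset.mem_univ, if_true,
    Finset.sum_mul]
  exact Finset.sum_congr rfl fun _ _ => Finset.sum_congr rfl fun _ _ => by ring

variable [DecidableEq B]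

theorem partialTraceRight_one_kronecker_cfc_mul {ω : Matrix B B ℂ} (hω : ω.IsHermitian)
    (f : ℝ → ℝ) (M : Matrix (A × B) (A × B) ℂ) :
    partialTraceRight ((1 ⊗ₖ cfc f ω) * M) = ∑ j, f (hω.eigenvalues j) •
      ((tensorVec A (hω.eigenvectorBasis j))ᴴ * M * tensorVec A (hω.eigenvectorBasis j)) := by
  rw [cfc_eq_sum_vecMulVec hω]
  simp only [kronecker_sum, kronecker_smul, Finset.sum_mul, Matrix.smul_mul, partialTraceRight_sum,
    partialTraceRight_smul, partialTraceRight_one_kronecker_vecMulVec_mul]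

theorem partialTraceRight_eq_sum_conjTranspose_tensorVec_mul {ω : Matrix B B ℂ}
    (hω : ω.IsHermitian) (M : Matrix (A × B) (A × B) ℂ) :
    partialTraceRight M = ∑ j,
      (tensorVec A (hω.eigenvectorBasis j))ᴴ * M * tensorVec A (hω.eigenvectorBasis j) := by
  have h := partialTraceRight_one_kronecker_cfc_mul hω (fun _ => 1) M
  simpa only [cfc_const_one ℝ ω hω.isSelfAdjoint, one_kronecker_one, Matrix.one_mul,
    one_smul] using h

theorem sum_smul_conjTranspose_tensorVec_mul_tensorVec {ω : Matrix B B ℂ} (hω : ω.IsHermitian)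
    (f : ℝ → ℝ) :
    ∑ j, f (hω.eigenvalues j) •
      ((tensorVec A (hω.eigenvectorBasis j))ᴴ * tensorVec A (hω.eigenvectorBasis j))
      = (cfc f ω).trace • (1 : Matrix A A ℂ) := by
  have h := partialTraceRight_one_kronecker_cfc_mul hω f (1 : Matrix (A × B) (A × B) ℂ)
  simpa only [Matrix.mul_one, partialTraceRight_kronecker] using h.symm

theorem partialTraceRight_one_kronecker_mul_cfc_log_add_le {P : Matrix (A × B) (A × B) ℂ}
    (hP : P.PosDef) {ω : Matrix B B ℂ} (hω : IsDensityMatrix ω) :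
    partialTraceRight ((1 ⊗ₖ ω) * cfc Real.log P) + vonNeumannEntropy ω • 1
      ≤ cfc Real.log (partialTraceRight P) := by
  have hωH := hω.1.isHermitian
  have hlog := partialTraceRight_one_kronecker_cfc_mul hωH id (cfc Real.log P)
  have hone := sum_smul_conjTranspose_tensorVec_mul_tensorVec (A := A) hωH id
  have hent := sum_smul_conjTranspose_tensorVec_mul_tensorVec (A := A) hωH Real.negMulLog
  rw [cfc_id ℝ ω hωH.isSelfAdjoint] at hlog hone
  rw [hω.2, one_smul] at hone
  rw [trace_cfc_negMulLog hωH, Complex.coe_smul] at hent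
  rw [hlog, ← hent, partialTraceRight_eq_sum_conjTranspose_tensorVec_mul hωH]
  exact sum_smul_conjTranspose_mul_cfc_log_mul_add_le hP hω.1.eigenvalues_nonneg hone

end PartialTrace

section Entropy

open Filter Topology

variable {A B n ι : Type*} [Fintype A] [DecidableEq A] [Fintype B] [DecidableEq B] [Fintype n]

theorem trace_mul_nonneg {X Y : Matrix n n ℂ} (hX : X.PosSemidef) (hY : Y.PosSemidef) :
    0 ≤ (X * Y).trace := by
  classical
  obtain ⟨C, rfl⟩ := CStarAlgebra.nonneg_iff_eq_star_mul_self.1 hX.nonneg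
  rw [star_eq_conjTranspose, ← trace_mul_cycle]
  exact (hY.mul_mul_conjTranspose_same C).trace_nonneg

theorem trace_mul_le_trace_mul {R X Y : Matrix n n ℂ} (hR : R.PosSemidef) (h : X ≤ Y) :
    (R * X).trace ≤ (R * Y).trace := by
  rw [← sub_nonneg, ← trace_sub, ← Matrix.mul_sub]
  exact trace_mul_nonneg hR h

variable [DecidableEq n]

theorem mul_cfc_add_smul_one {M : Matrix n n ℂ} (hM : M.IsHermitian) (f : ℝ → ℝ) (c : ℝ) :
    M * cfc f (M + c • 1) = cfc (fun x => x * f (x + c)) M := by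
  have hcont (g : ℝ → ℝ) : ContinuousOn g (spectrum ℝ M) := M.finite_real_spectrum.continuousOn g
  rw [cfc_mul _ _ M (hcont _) (hcont _), cfc_id' ℝ M hM.isSelfAdjoint,
    cfc_comp' f (· + c) M ((M.finite_real_spectrum.image _).continuousOn f) (hcont _)
      hM.isSelfAdjoint,
    cfc_add_const c (fun x => x) M (hcont _) hM.isSelfAdjoint, cfc_id' ℝ M hM.isSelfAdjoint,
    Algebra.algebraMap_eq_smul_one]

theorem tendsto_trace_mul_cfc_log_add_smul_one {M : Matrix n n ℂ} (hM : M.IsHermitian) :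
    Tendsto (fun c : ℝ => (M * cfc Real.log (M + c • 1)).trace.re) (𝓝 0)
      (𝓝 (-vonNeumannEntropy M)) := by
  simp only [vonNeumannEntropy, mul_cfc_add_smul_one hM, trace_cfc hM, Complex.ofReal_re,
    ← Finset.sum_neg_distrib, Real.negMulLog, neg_mul, neg_neg]
  refine tendsto_finsetSum _ fun i _ => ?_
  rcases eq_or_ne (hM.eigenvalues i) 0 with h0 | h0
  · simp [h0]
  · have h : ContinuousAt (fun c => hM.eigenvalues i * Real.log (hM.eigenvalues i + c)) 0 := by
      fun_prop (disch := simpa using h0)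
    simpa [ContinuousAt] using h

theorem vonNeumannEntropy_nonneg {ρ : Matrix n n ℂ} (hρ : IsDensityMatrix ρ) :
    0 ≤ vonNeumannEntropy ρ := by
  have hρH := hρ.1.isHermitian
  have hsum : ∑ i, hρH.eigenvalues i = 1 := by
    have h := trace_cfc hρH id
    rw [cfc_id ℝ ρ hρH.isSelfAdjoint, hρ.2] at h
    exact_mod_cast h.symm
  rw [vonNeumannEntropy, trace_cfc hρH, Complex.ofReal_re]
  refine Finset.sum_nonneg fun i hi => Real.negMulLog_nonneg (hρ.1.eigenvalues_nonneg i) ?_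
  rw [← hsum]
  exact Finset.single_le_sum (fun j _ => hρ.1.eigenvalues_nonneg j) hi

/-- Pair the operator inequality for `∑ k, R k ⊗ₖ ω k + c • 1` with each `R k` and sum over `k`;
the regularization by `c • 1` makes the logarithm operator concave and monotone. -/
theorem trace_sum_kronecker_mul_cfc_log_add_le [Fintype ι] {R : ι → Matrix A A ℂ}
    {ω : ι → Matrix B B ℂ} (hR : ∀ k, (R k).PosSemidef) (hω : ∀ k, IsDensityMatrix (ω k))
    {c : ℝ} (hc : 0 < c) :
    ((∑ k, R k ⊗ₖ ω k) * cfc Real.log (∑ k, R k ⊗ₖ ω k + c • 1)).trace.re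
        + ∑ k, (R k).trace.re * vonNeumannEntropy (ω k)
      ≤ ((∑ k, R k) * cfc Real.log (∑ k, R k + (Fintype.card B * c) • 1)).trace.re := by
  set P := ∑ k, R k ⊗ₖ ω k + c • (1 : Matrix (A × B) (A × B) ℂ) with hPdef
  have hP : P.PosDef :=
    (PosDef.one.smul hc).posSemidef_add (posSemidef_sum _ fun k _ => (hR k).kronecker (hω k).1)
  have hPtr : partialTraceRight P = ∑ k, R k + (Fintype.card B * c) • 1 := by
    simp only [hPdef, partialTraceRight_add, ← one_kronecker_one, partialTraceRight_sum,
      partialTraceRight_smul, partialTraceRight_kronecker, (hω _).2, one_smul, trace_one]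
    module
  have hk (k : ι) : ((R k ⊗ₖ ω k) * cfc Real.log P).trace + (R k).trace * vonNeumannEntropy (ω k)
      ≤ (R k * cfc Real.log (partialTraceRight P)).trace := by
    have h := trace_mul_le_trace_mul (hR k)
      (partialTraceRight_one_kronecker_mul_cfc_log_add_le hP (hω k))
    rwa [Matrix.mul_add, trace_add, ← trace_kronecker_mul, Matrix.mul_smul, Matrix.mul_one,
      trace_smul, Complex.real_smul, mul_comm] at h
  have h := (Complex.le_def.1 (Finset.sum_le_sum fun k (_ : k ∈ Finset.univ) => hk k)).1
  rw [← hPtr]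
  simpa [Finset.sum_mul, trace_sum, Finset.sum_add_distrib] using h

theorem vonNeumannEntropy_add_sum_le_vonNeumannEntropy_sum_kronecker [Fintype ι]
    {R : ι → Matrix A A ℂ} {ω : ι → Matrix B B ℂ} (hR : ∀ k, (R k).PosSemidef)
    (hω : ∀ k, IsDensityMatrix (ω k)) :
    vonNeumannEntropy (∑ k, R k) + ∑ k, (R k).trace.re * vonNeumannEntropy (ω k)
      ≤ vonNeumannEntropy (∑ k, R k ⊗ₖ ω k) := by
  have hN : (∑ k, R k).IsHermitian := (posSemidef_sum _ fun k _ => hR k).isHermitian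
  have hσ : (∑ k, R k ⊗ₖ ω k).IsHermitian :=
    (posSemidef_sum _ fun k _ => (hR k).kronecker (hω k).1).isHermitian
  have hleft := (tendsto_trace_mul_cfc_log_add_smul_one hσ).mono_left
    (nhdsWithin_le_nhds (s := Set.Ioi 0))
  have hmul : Tendsto (fun c : ℝ => Fintype.card B * c) (𝓝[>] 0) (𝓝 0) :=
    (Continuous.tendsto' (by fun_prop) 0 0 (mul_zero _)).mono_left nhdsWithin_le_nhds
  have hle := le_of_tendsto_of_tendsto (hleft.add_const _)
    ((tendsto_trace_mul_cfc_log_add_smul_one hN).comp hmul)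
    (eventually_nhdsWithin_of_forall fun c hc =>
      trace_sum_kronecker_mul_cfc_log_add_le hR hω hc)
  linarith

end Entropy

section Marginals

variable {A B ι : Type*}

theorem trace_partialTraceRight [Fintype A] [Fintype B] (τ : Matrix (A × B) (A × B) ℂ) :
    (partialTraceRight τ).trace = τ.trace := by
  simp only [trace, diag_apply, partialTraceRight, of_apply, Fintype.sum_prod_type]

theorem trace_partialTraceLeft [Fintype A] [Fintype B] (τ : Matrix (A × B) (A × B) ℂ) :
    (partialTraceLeft τ).trace = τ.trace := by
  simp only [trace, diag_apply, partialTraceLeft, of_apply, Fintype.sum_prod_type_right]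

theorem posSemidef_partialTraceRight [Fintype B] {τ : Matrix (A × B) (A × B) ℂ}
    (hτ : τ.PosSemidef) : (partialTraceRight τ).PosSemidef := by
  have h : partialTraceRight τ = ∑ j, τ.submatrix (·, j) (·, j) := by
    ext i i'
    simp [partialTraceRight, Matrix.sum_apply]
  rw [h]
  exact posSemidef_sum _ fun j _ => hτ.submatrix _

theorem posSemidef_partialTraceLeft [Fintype A] {τ : Matrix (A × B) (A × B) ℂ}
    (hτ : τ.PosSemidef) : (partialTraceLeft τ).PosSemidef := by
  have h : partialTraceLeft τ = ∑ i, τ.submatrix (i, ·) (i, ·) := by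
    ext j j'
    simp [partialTraceLeft, Matrix.sum_apply]
  rw [h]
  exact posSemidef_sum _ fun i _ => hτ.submatrix _

theorem IsDensityMatrix.partialTraceRight [Fintype A] [Fintype B]
    {τ : Matrix (A × B) (A × B) ℂ} (hτ : IsDensityMatrix τ) :
    IsDensityMatrix (partialTraceRight τ) :=
  ⟨posSemidef_partialTraceRight hτ.1, (trace_partialTraceRight τ).trans hτ.2⟩

theorem IsDensityMatrix.partialTraceLeft [Fintype A] [Fintype B]
    {τ : Matrix (A × B) (A × B) ℂ} (hτ : IsDensityMatrix τ) :
    IsDensityMatrix (partialTraceLeft τ) :=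
  ⟨posSemidef_partialTraceLeft hτ.1, (trace_partialTraceLeft τ).trans hτ.2⟩

theorem partialTraceLeft_add [Fintype A] (τ σ : Matrix (A × B) (A × B) ℂ) :
    partialTraceLeft (τ + σ) = partialTraceLeft τ + partialTraceLeft σ := by
  ext j j'
  simp [partialTraceLeft, Finset.sum_add_distrib]

theorem partialTraceLeft_smul [Fintype A] (c : ℂ) (τ : Matrix (A × B) (A × B) ℂ) :
    partialTraceLeft (c • τ) = c • partialTraceLeft τ := by
  ext j j'
  simp [partialTraceLeft, Finset.mul_sum]

theorem partialTraceLeft_sum [Fintype A] (s : Finset ι) (τ : ι → Matrix (A × B) (A × B) ℂ) :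
    partialTraceLeft (∑ k ∈ s, τ k) = ∑ k ∈ s, partialTraceLeft (τ k) := by
  ext j j'
  simp only [partialTraceLeft, of_apply, Matrix.sum_apply]
  exact Finset.sum_comm

theorem partialTraceLeft_kronecker [Fintype A] (X : Matrix A A ℂ) (Y : Matrix B B ℂ) :
    partialTraceLeft (X ⊗ₖ Y) = X.trace • Y := by
  ext j j'
  simp [partialTraceLeft, ← Finset.sum_mul, trace]

end Marginals

section Measurement

variable {A A' B B' ι : Type*}

theorem linearMap_ext_kronecker [Finite A] [Finite B] {M : Type*} [AddCommMonoid M] [Module ℂ M]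
    {F G : Matrix (A × B) (A × B) ℂ →ₗ[ℂ] M}
    (h : ∀ (X : Matrix A A ℂ) (Y : Matrix B B ℂ), F (X ⊗ₖ Y) = G (X ⊗ₖ Y)) : F = G := by
  classical
  cases nonempty_fintype A
  cases nonempty_fintype B
  refine ext_linearMap ℂ fun p q => LinearMap.ext_ring ?_
  simpa [single_kronecker_single] using h (single p.1 q.1 1) (single p.2 q.2 1)

variable [Fintype A] [Fintype B]

theorem exists_isDensityMatrix_eq_trace_smul {M ρ : Matrix B B ℂ} (hρ : IsDensityMatrix ρ)
    (hM : M.PosSemidef) : ∃ σ, IsDensityMatrix σ ∧ M = M.trace • σ := by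
  have htr : 0 ≤ M.trace⁻¹ := inv_nonneg.2 hM.trace_nonneg
  by_cases h0 : M.trace = 0
  · exact ⟨ρ, hρ, by rw [h0, zero_smul, hM.trace_eq_zero_iff.1 h0]⟩
  · exact ⟨M.trace⁻¹ • M, ⟨hM.smul htr, by rw [trace_smul, smul_eq_mul, inv_mul_cancel₀ h0]⟩,
      by rw [smul_smul, mul_inv_cancel₀ h0, one_smul]⟩

variable [DecidableEq B]

/-- The unnormalized state of the second factor after measuring the effect `X` on the first
factor, as a linear function of the bipartite state. -/
def postMeasurement (X : Matrix A A ℂ) : Matrix (A × B) (A × B) ℂ →ₗ[ℂ] Matrix B B ℂ where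
  toFun τ := partialTraceLeft ((X ⊗ₖ 1) * τ)
  map_add' τ σ := by rw [Matrix.mul_add, partialTraceLeft_add]
  map_smul' c τ := by rw [Matrix.mul_smul, partialTraceLeft_smul, RingHom.id_apply]

theorem postMeasurement_apply (X : Matrix A A ℂ) (τ : Matrix (A × B) (A × B) ℂ) :
    postMeasurement X τ = partialTraceLeft ((X ⊗ₖ 1) * τ) :=
  rfl

theorem trace_postMeasurement (X : Matrix A A ℂ) (τ : Matrix (A × B) (A × B) ℂ) :
    (postMeasurement X τ).trace = (X * partialTraceRight τ).trace := by
  rw [postMeasurement_apply, trace_partialTraceLeft, trace_kronecker_one_mul]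

theorem postMeasurement_kronecker (X Y : Matrix A A ℂ) (Z : Matrix B B ℂ) :
    postMeasurement X (Y ⊗ₖ Z) = (X * Y).trace • Z := by
  rw [postMeasurement_apply, ← mul_kronecker_mul, Matrix.one_mul, partialTraceLeft_kronecker]

theorem partialTraceLeft_mul_kronecker_one (C : Matrix A A ℂ) (τ : Matrix (A × B) (A × B) ℂ) :
    partialTraceLeft (τ * (C ⊗ₖ 1)) = partialTraceLeft ((C ⊗ₖ 1) * τ) := by
  ext j j'
  simp only [partialTraceLeft, of_apply, mul_apply, Fintype.sum_prod_type, kroneckerMap_apply,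
    one_apply, mul_ite, ite_mul, mul_one, mul_zero, zero_mul, Finset.sum_ite_eq,
    Finset.sum_ite_eq', Finset.mem_univ, if_true]
  rw [Finset.sum_comm]
  exact Finset.sum_congr rfl fun _ _ => Finset.sum_congr rfl fun _ _ => mul_comm _ _

theorem posSemidef_postMeasurement {X : Matrix A A ℂ} (hX : X.PosSemidef)
    {τ : Matrix (A × B) (A × B) ℂ} (hτ : τ.PosSemidef) : (postMeasurement X τ).PosSemidef := by
  classical
  obtain ⟨C, rfl⟩ := CStarAlgebra.nonneg_iff_eq_star_mul_self.1 hX.nonneg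
  have h : postMeasurement (star C * C) τ = partialTraceLeft ((C ⊗ₖ 1) * τ * (C ⊗ₖ 1)ᴴ) := by
    rw [postMeasurement_apply, conjTranspose_kronecker, conjTranspose_one,
      partialTraceLeft_mul_kronecker_one, ← Matrix.mul_assoc, ← mul_kronecker_mul, Matrix.one_mul,
      star_eq_conjTranspose]
  rw [h]
  exact posSemidef_partialTraceLeft (hτ.mul_mul_conjTranspose_same _)

variable [DecidableEq A]

theorem sum_postMeasurement [Fintype ι] {X : ι → Matrix A A ℂ} (hX : ∑ k, X k = 1)
    (τ : Matrix (A × B) (A × B) ℂ) :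
    ∑ k, postMeasurement (X k) τ = partialTraceLeft τ := by
  simp only [postMeasurement_apply]
  rw [← partialTraceLeft_sum, ← Finset.sum_mul, ← sum_kronecker, hX, one_kronecker_one,
    Matrix.one_mul]

theorem tensorMap_eq_sum_kronecker [Fintype ι] {Φ : Matrix A A ℂ →ₗ[ℂ] Matrix A' A' ℂ}
    {R : ι → Matrix A' A' ℂ} {X : ι → Matrix A A ℂ}
    (hΦ : ∀ ρ : Matrix A A ℂ, Φ ρ = ∑ k, (X k * ρ).trace • R k)
    (Ω : Matrix B B ℂ →ₗ[ℂ] Matrix B' B' ℂ) (τ : Matrix (A × B) (A × B) ℂ) :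
    tensorMap Φ Ω τ = ∑ k, R k ⊗ₖ Ω (postMeasurement (X k) τ) := by
  let F : Matrix (A × B) (A × B) ℂ →ₗ[ℂ] Matrix (A' × B') (A' × B') ℂ :=
    ∑ k, kroneckerBilinear (R := ℂ) (R k) ∘ₗ Ω ∘ₗ postMeasurement (X k)
  have hF : tensorMap Φ Ω = F := linearMap_ext_kronecker fun Y Z => by
    simp [F, kroneckerBilinear, tensorMap_kronecker, hΦ, sum_kronecker, smul_kronecker,
      postMeasurement_kronecker]
  simp [hF, F, kroneckerBilinear]

end Measurement

section AverageEntropy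

variable {A A' B B' ι : Type*}

theorem IsChannel.isDensityMatrix [Fintype B] [DecidableEq B] [Fintype B']
    {Ω : Matrix B B ℂ →ₗ[ℂ] Matrix B' B' ℂ} (hΩ : IsChannel Ω) {ρ : Matrix B B ℂ}
    (hρ : IsDensityMatrix ρ) : IsDensityMatrix (Ω ρ) := by
  refine ⟨?_, (hΩ.2 ρ).trans hρ.2⟩
  have h := (hΩ.1 1 (1 ⊗ₖ ρ) (PosSemidef.one.kronecker hρ.1)).submatrix fun b => (0, b)
  rw [tensorMap_kronecker] at h
  convert h
  ext b b'
  simp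

theorem IsEntanglementBreaking.isDensityMatrix [Fintype A] [DecidableEq A] [Fintype A']
    {Φ : Matrix A A ℂ →ₗ[ℂ] Matrix A' A' ℂ} (hΦ : IsEntanglementBreaking Φ)
    {ρ : Matrix A A ℂ} (hρ : IsDensityMatrix ρ) : IsDensityMatrix (Φ ρ) := by
  obtain ⟨K, R, X, hR, hX, hX1, hΦ⟩ := hΦ
  rw [hΦ]
  refine ⟨posSemidef_sum _ fun k _ => (hR k).1.smul (trace_mul_nonneg (hX k) hρ.1), ?_⟩
  simp only [trace_sum, trace_smul, (hR _).2, smul_eq_mul, mul_one]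
  rw [← trace_sum, ← Finset.sum_mul, hX1, Matrix.one_mul, hρ.2]

theorem minAverageEntropy_le [Fintype A] [Fintype A'] [DecidableEq A'] [Fintype ι]
    {Ω : Matrix A A ℂ →ₗ[ℂ] Matrix A' A' ℂ} (hΩ : ∀ ρ, IsDensityMatrix ρ → IsDensityMatrix (Ω ρ))
    {ρ : Matrix A A ℂ} {p : ι → ℝ} {σ : ι → Matrix A A ℂ} (hp : ∀ k, 0 ≤ p k)
    (hp1 : ∑ k, p k = 1) (hσ : ∀ k, IsDensityMatrix (σ k)) (hρ : ∑ k, (p k : ℂ) • σ k = ρ) :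
    minAverageEntropy Ω ρ ≤ ∑ k, p k * vonNeumannEntropy (Ω (σ k)) := by
  let e := (Fintype.equivFin ι).symm
  refine csInf_le ⟨0, ?_⟩ ⟨Fintype.card ι, p ∘ e, σ ∘ e, fun k => hp _, ?_, fun k => hσ _, ?_, ?_⟩
  · rintro s ⟨n, p, σ, hp, -, hσ, -, rfl⟩
    exact Finset.sum_nonneg fun k _ =>
      mul_nonneg (hp k) (vonNeumannEntropy_nonneg (hΩ _ (hσ k)))
  · exact (e.sum_comp p).trans hp1
  · exact (e.sum_comp fun k => (p k : ℂ) • σ k).trans hρ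
  · exact (e.sum_comp fun k => p k * vonNeumannEntropy (Ω (σ k))).symm

variable [Fintype A] [DecidableEq A] [Fintype A'] [DecidableEq A'] [Fintype B] [DecidableEq B]
  [Fintype B'] [DecidableEq B'] {Φ : Matrix A A ℂ →ₗ[ℂ] Matrix A' A' ℂ}
  {Ω : Matrix B B ℂ →ₗ[ℂ] Matrix B' B' ℂ}

theorem exists_ensemble_of_sum_eq_one [Fintype ι] {X : ι → Matrix A A ℂ}
    (hX : ∀ k, (X k).PosSemidef) (hX1 : ∑ k, X k = 1) {τ : Matrix (A × B) (A × B) ℂ}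
    (hτ : IsDensityMatrix τ) :
    ∃ (q : ι → ℝ) (σ : ι → Matrix B B ℂ), (∀ k, 0 ≤ q k) ∧ ∑ k, q k = 1 ∧
      (∀ k, IsDensityMatrix (σ k)) ∧ ∀ k, postMeasurement (X k) τ = (q k : ℂ) • σ k := by
  have hpsd (k : ι) : (postMeasurement (X k) τ).PosSemidef := posSemidef_postMeasurement (hX k) hτ.1
  choose σ hσ hpost using fun k => exists_isDensityMatrix_eq_trace_smul hτ.partialTraceLeft (hpsd k)
  refine ⟨fun k => (postMeasurement (X k) τ).trace.re, σ,
    fun k => (Complex.le_def.1 (hpsd k).trace_nonneg).1, ?_, hσ, fun k => ?_⟩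
  · rw [← Complex.re_sum, ← trace_sum, sum_postMeasurement hX1, hτ.partialTraceLeft.2,
      Complex.one_re]
  · rw [← Complex.eq_re_of_ofReal_le (hpsd k).trace_nonneg]
    exact hpost k

theorem IsEntanglementBreaking.exists_ensemble_entropy_add_le (hΦ : IsEntanglementBreaking Φ)
    (hΩ : ∀ ρ, IsDensityMatrix ρ → IsDensityMatrix (Ω ρ)) : ∃ K : ℕ,
    ∀ {τ : Matrix (A × B) (A × B) ℂ}, IsDensityMatrix τ →
    ∃ (q : Fin K → ℝ) (σ : Fin K → Matrix B B ℂ), (∀ k, 0 ≤ q k) ∧ ∑ k, q k = 1 ∧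
      (∀ k, IsDensityMatrix (σ k)) ∧ ∑ k, (q k : ℂ) • σ k = partialTraceLeft τ ∧
      vonNeumannEntropy (Φ (partialTraceRight τ)) + ∑ k, q k * vonNeumannEntropy (Ω (σ k))
        ≤ vonNeumannEntropy (tensorMap Φ Ω τ) := by
  obtain ⟨K, R, X, hR, hX, hX1, hΦ⟩ := hΦ
  refine ⟨K, fun {τ} hτ => ?_⟩
  obtain ⟨q, σ, hq, hq1, hσ, hpost⟩ := exists_ensemble_of_sum_eq_one hX hX1 hτ
  refine ⟨q, σ, hq, hq1, hσ, by simp only [← hpost, sum_postMeasurement hX1], ?_⟩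
  have hmarginal : Φ (partialTraceRight τ) = ∑ k, (q k : ℂ) • R k := by
    simp only [hΦ, ← trace_postMeasurement, hpost, trace_smul, (hσ _).2, smul_eq_mul, mul_one]
  have houtput : tensorMap Φ Ω τ = ∑ k, ((q k : ℂ) • R k) ⊗ₖ Ω (σ k) := by
    simp only [tensorMap_eq_sum_kronecker hΦ, hpost, map_smul, kronecker_smul, smul_kronecker]
  have h := vonNeumannEntropy_add_sum_le_vonNeumannEntropy_sum_kronecker
    (fun k => (hR k).1.smul (Complex.zero_le_real.2 (hq k))) fun k => hΩ _ (hσ k)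
  simpa only [hmarginal, houtput, trace_smul, (hR _).2, smul_eq_mul, mul_one,
    Complex.ofReal_re] using h

theorem lemma3_general {A A' B B' : Type*}
    [Fintype A] [DecidableEq A] [Fintype A'] [DecidableEq A']
    [Fintype B] [DecidableEq B] [Fintype B'] [DecidableEq B']
    (Φ : Matrix A A ℂ →ₗ[ℂ] Matrix A' A' ℂ) (hΦ : IsEntanglementBreaking Φ)
    (Ω : Matrix B B ℂ →ₗ[ℂ] Matrix B' B' ℂ) (hΩ : ∀ ρ, IsDensityMatrix ρ → IsDensityMatrix (Ω ρ))
    (τ : Matrix (A × B) (A × B) ℂ) (hτ : IsDensityMatrix τ) :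
    minAverageEntropy (tensorMap Φ Ω) τ ≥
      minAverageEntropy Φ (partialTraceRight τ) + minAverageEntropy Ω (partialTraceLeft τ) := by
  refine le_csInf ⟨_, 1, fun _ => 1, fun _ => τ, by simp, by simp, fun _ => hτ, by simp, rfl⟩ ?_
  rintro s ⟨n, p, ρ, hp, hp1, hρ, hρτ, rfl⟩
  obtain ⟨K, hK⟩ := hΦ.exists_ensemble_entropy_add_le hΩ
  choose q σ hq hq1 hσ hσρ hle using fun l => hK (hρ l)
  have hright := minAverageEntropy_le (fun _ => hΦ.isDensityMatrix) (ρ := partialTraceRight τ)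
    hp hp1 (fun l => (hρ l).partialTraceRight)
    (by simp only [← hρτ, partialTraceRight_sum, partialTraceRight_smul])
  have hleft := minAverageEntropy_le hΩ (ρ := partialTraceLeft τ)
    (p := fun x : Fin n × Fin K => p x.1 * q x.1 x.2) (fun x => mul_nonneg (hp _) (hq _ _))
    (by simp only [Fintype.sum_prod_type, ← Finset.mul_sum, hq1, mul_one, hp1])
    (fun x => hσ x.1 x.2)
    (by simp only [← hρτ, partialTraceLeft_sum, partialTraceLeft_smul, Fintype.sum_prod_type,
      Complex.ofReal_mul, mul_smul, ← Finset.smul_sum, hσρ])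
  refine (add_le_add hright hleft).trans ?_
  rw [Fintype.sum_prod_type, ← Finset.sum_add_distrib]
  refine Finset.sum_le_sum fun l _ => ?_
  simp only [mul_assoc, ← Finset.mul_sum, ← mul_add]
  exact mul_le_mul_of_nonneg_left (hle l) (hp l)

end AverageEntropy

theorem lemma3 {A A' B B' : Type*}
    [Fintype A] [DecidableEq A] [Fintype A'] [DecidableEq A']
    [Fintype B] [DecidableEq B] [Fintype B'] [DecidableEq B']
    (Φ : Matrix A A ℂ →ₗ[ℂ] Matrix A' A' ℂ) (hΦ : IsEntanglementBreaking Φ)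
    (Ω : Matrix B B ℂ →ₗ[ℂ] Matrix B' B' ℂ) (hΩ : IsChannel Ω)
    (τ : Matrix (A × B) (A × B) ℂ) (hτ : IsDensityMatrix τ) :
    minAverageEntropy (tensorMap Φ Ω) τ ≥
      minAverageEntropy Φ (partialTraceRight τ) + minAverageEntropy Ω (partialTraceLeft τ) :=
  lemma3_general Φ hΦ Ω (fun _ => hΩ.isDensityMatrix) τ hτ
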